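/- Let $\gamma$ be the probability measure on $\mathbb{R}$ with density $\pi^{-1/2}e^{-t^2}$, let $\theta=\gamma\otimes\gamma\otimes\gamma$ on $\mathbb{R}^3$, and let $k(x,y)=\exp(-|x-y|^2)$ for $x,y\in\mathbb{R}^3$, where $|\cdot|$ is the Euclidean norm. Let $H_n$ be the Hermite polynomials, $H_0(t)=1$, $H_1(t)=2t$, $H_{n+1}(t)=2tH_n(t)-2nH_{n-1}(t)$ for $n\ge 1$. For integers $n\ge 0$ put $$\lambda_n=a^{\,n+1/2},\qquad \phi_n(t)=\frac{b}{\sqrt{2^n n!}}\,e^{-ct^2}H_n(ht),$$ where $a=\dfrac{1}{1+\frac{1+\sqrt5}{2}}$, $b=5^{1/8}$, $c=\dfrac{\sqrt5-1}{2}$, $h=5^{1/4}$. For integers $m,n,p\ge 0$ and $x=(x_1,x_2,x_3)\in\mathbb{R}^3$ put $\tau_{m,n,p}=\lambda_m\lambda_n\lambda_p$ and $\psi_{m,n,p}(x)=\phi_m(x_1)\phi_n(x_2)\phi_p(x_3)$. Theorem. Let $(Z_{m,n,p})_{m,n,p\ge 0}$ be independent standard Gaussian random variables on a probability space $(\Omega,P)$.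 Then $P$-almost surely, for all $x\in\mathbb{R}^3$ simultaneously, the series $$U_x=\sum_{m,n,p\ge 0} Z_{m,n,p}\sqrt{\tau_{m,n,p}}\;\psi_{m,n,p}(x)$$ converges (unconditionally) to a finite limit. The random field $(U_x)_{x\in\mathbb{R}^3}$ is Gaussian, with mean $E(U_x)=0$ and covariance $E(U_xU_y)=k(x,y)$ for all $x,y\in\mathbb{R}^3$. $P$-almost surely, the function $x\mapsto U_x$ belongs to $L^2(\mathbb{R}^3,\theta)$ and is infinitely differentiable on $\mathbb{R}^3$, and the series converges (unconditionally) to $U$ also in the norm of $L^2(\mathbb{R}^3,\theta)$. -/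

import Mathlib

open MeasureTheory ProbabilityTheory Filter
open scoped Topology ENNReal

noncomputable section

namespace GaussField

/-- Three-dimensional Euclidean space. -/
abbrev E3 : Type := EuclideanSpace ℝ (Fin 3)

/-- The probability measure on `ℝ` with density `exp (-t ^ 2) / √π`. -/
def gammaMeasure : Measure ℝ :=
  (volume : Measure ℝ).withDensity
    (fun t => ENNReal.ofReal (1 / Real.sqrt Real.pi * Real.exp (-t ^ 2)))

/-- The product measure `γ ⊗ γ ⊗ γ`, carried by Euclidean space. -/
def theta : Measure E3 :=
  (Measure.pi (fun _ : Fin 3 => gammaMeasure)).map (WithLp.toLp 2)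

/-- The (physicists') Hermite polynomials, as functions, by their three-term recursion
`H (n + 1) t = 2 t H n t - 2 n H (n - 1) t`. -/
def hermiteH : ℕ → ℝ → ℝ
  | 0, _ => 1
  | 1, t => 2 * t
  | n + 2, t => 2 * t * hermiteH (n + 1) t - 2 * ((n : ℝ) + 1) * hermiteH n t

/-- The ratio of two consecutive eigenvalues of the one-dimensional Gaussian kernel operator. -/
def a : ℝ := 1 / (1 + (1 + Real.sqrt 5) / 2)

/-- The normalising constant of the eigenfunctions. -/
def b : ℝ := (5 : ℝ) ^ (1 / 8 : ℝ)

/-- The rate of the Gaussian factor of the eigenfunctions. -/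
def c : ℝ := (Real.sqrt 5 - 1) / 2

/-- The scaling of the argument of the Hermite polynomials. -/
def h : ℝ := (5 : ℝ) ^ (1 / 4 : ℝ)

/-- The one-dimensional eigenvalues. -/
def lam (n : ℕ) : ℝ := a ^ ((n : ℝ) + 1 / 2)

/-- The one-dimensional eigenfunctions. -/
def phi (n : ℕ) (t : ℝ) : ℝ :=
  b / Real.sqrt (2 ^ n * (n.factorial : ℝ)) * Real.exp (-c * t ^ 2) * hermiteH n (h * t)

/-- The eigenvalues of the Gaussian kernel on `ℝ³`, indexed by triples `(m, n, p)`. -/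
def tau (q : ℕ × ℕ × ℕ) : ℝ := lam q.1 * lam q.2.1 * lam q.2.2

/-- The eigenfunctions of the Gaussian kernel on `ℝ³`, indexed by triples `(m, n, p)`. -/
def psi (q : ℕ × ℕ × ℕ) (x : E3) : ℝ := phi q.1 (x 0) * phi q.2.1 (x 1) * phi q.2.2 (x 2)

/-- The radial Gaussian kernel on `ℝ³`. -/
def kernel (x y : E3) : ℝ := Real.exp (-‖x - y‖ ^ 2)

/-- The general term of the stochastic series. -/
def seriesTerm {Ω : Type*} (Z : ℕ × ℕ × ℕ → Ω → ℝ) (q : ℕ × ℕ × ℕ) (x : E3) (ω : Ω) : ℝ :=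
  Z q ω * Real.sqrt (tau q) * psi q x

/-- The sum of the stochastic series (meaningful where the series converges). -/
def U {Ω : Type*} (Z : ℕ × ℕ × ℕ → Ω → ℝ) (x : E3) (ω : Ω) : ℝ :=
  ∑' q : ℕ × ℕ × ℕ, seriesTerm Z q x ω

end GaussField

end

/-!
The theorem rests on Mehler's formula, on decay estimates for the eigenfunctions drawn from that
formula, and on the stability of Gaussian laws under almost sure limits.

Mehler's formula (`hasSum_mehler`) is proved from the moment representation
`H_n(x) = π ^ (-1/2) ∫ (2 (x + i w)) ^ n exp (-w ^ 2) dw`: the series becomes a double Gaussian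
integral of an exponential. With the constants `a`, `b`, `c`, `h` it says that
`∑ λ_n φ_n(s) φ_n(t) = exp (-(s - t) ^ 2)`, and taking products gives the expansion of the kernel on
`ℝ³` (`hasSum_kernel`).

On the diagonal and with ratio `1 / 2 > a`, Mehler's formula bounds each `√λ_n |φ_n(t)|` by
`4 ρ ^ n exp (a t ^ 2 / 3)` with `ρ = √(2 a) < 1` (`abs_sqrt_lam_mul_phi_le`). The geometric decay
gives convergence, and `2 a / 3 < 1` makes the Gaussian factor square integrable against `γ`. Since
`∑ E |Z_q| w_q < ∞` for every summable weight `w`, almost surely `∑ |Z_q| w_q < ∞` for all the weights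
`(m + 1) ^ k (n + 1) ^ k (p + 1) ^ k ρ ^ (m + n + p)`. On this event everything pathwise is
deterministic: the series is dominated by a convergent series of numbers times one fixed function
in `L²(θ)`, which gives pointwise convergence and convergence in `L²(θ)`.

For smoothness, multiplication by `exp (-|x| ^ 2 / 2)` turns the eigenfunctions into dilated Hermite
functions. The ladder relation `deriv_hermiteFun` then bounds all derivatives uniformly in space at
the cost of a polynomial factor in the indices, and the damped series can be differentiated term by
term (`contDiff_tsum_term`).

A linear combination of values of `U` is again an almost surely convergent series
`∑ Z_q e_q` with `∑ e_q ^ 2 < ∞`. Convergence of characteristic functions shows that it is a centred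
Gaussian variable of variance `∑ e_q ^ 2` (`hasLaw_gaussianReal_of_hasSum`), and the kernel expansion
evaluates this variance. That yields the Gaussian process property, the mean and, by polarization,
the covariance.
-/

namespace GaussField

/-! ### Hermite polynomials as complex Gaussian moments -/

lemma norm_ofReal_add_mul_I_sq (x w : ℝ) : ‖(x + w * Complex.I : ℂ)‖ ^ 2 = x ^ 2 + w ^ 2 := by
  rw [← Complex.normSq_eq_norm_sq, Complex.normSq_add_mul_I]

lemma integrable_pow_mul_gaussian (x : ℝ) (n : ℕ) :
    Integrable (fun w : ℝ => (x + w * Complex.I : ℂ) ^ n * (Real.exp (-w ^ 2) : ℂ)) := by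
  have hg : Integrable (fun w : ℝ =>
      n.factorial * Real.exp ((1 + x ^ 2) / 2) * Real.exp (-(1 / 2) * w ^ 2)) :=
    (integrable_exp_neg_mul_sq (by norm_num)).const_mul _
  refine hg.mono' (by fun_prop) (Eventually.of_forall fun w => ?_)
  have h1 := Real.pow_div_factorial_le_exp _ (norm_nonneg (x + w * Complex.I : ℂ)) n
  rw [div_le_iff₀ (by positivity)] at h1
  have h2 : ‖(x + w * Complex.I : ℂ)‖ ≤ (1 + x ^ 2) / 2 + w ^ 2 / 2 := by
    nlinarith [norm_ofReal_add_mul_I_sq x w, sq_nonneg (‖(x + w * Complex.I : ℂ)‖ - 1)]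
  rw [norm_mul, norm_pow, Complex.norm_real, Real.norm_of_nonneg (Real.exp_nonneg _)]
  calc _ ≤ Real.exp ((1 + x ^ 2) / 2 + w ^ 2 / 2) * n.factorial * Real.exp (-w ^ 2) := by
        gcongr
        exact h1.trans (by gcongr)
    _ = _ := by
        have : Real.exp (-(1 / 2) * w ^ 2) = Real.exp (w ^ 2 / 2) * Real.exp (-w ^ 2) := by
          rw [← Real.exp_add]; ring_nf
        rw [Real.exp_add, this]; ring

/-- The recursion of the Gaussian moments `∫ (x + i w) ^ n exp (-w ^ 2) dw`: integrate the
derivative of `(x + i w) ^ n exp (-w ^ 2)`. -/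
lemma integral_pow_succ_mul_gaussian (x : ℝ) (n : ℕ) :
    ∫ w : ℝ, (x + w * Complex.I : ℂ) ^ (n + 1) * (Real.exp (-w ^ 2) : ℂ) =
      x * (∫ w : ℝ, (x + w * Complex.I : ℂ) ^ n * (Real.exp (-w ^ 2) : ℂ)) -
      n / 2 * (∫ w : ℝ, (x + w * Complex.I : ℂ) ^ (n - 1) * (Real.exp (-w ^ 2) : ℂ)) := by
  have hd (w : ℝ) : HasDerivAt
      (fun w : ℝ => (x + w * Complex.I : ℂ) ^ n * (Real.exp (-w ^ 2) : ℂ))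
      (2 * Complex.I * ((x + w * Complex.I : ℂ) ^ (n + 1) * (Real.exp (-w ^ 2) : ℂ)) -
        2 * Complex.I * x * ((x + w * Complex.I : ℂ) ^ n * (Real.exp (-w ^ 2) : ℂ)) +
        n * Complex.I * ((x + w * Complex.I : ℂ) ^ (n - 1) * (Real.exp (-w ^ 2) : ℂ))) w := by
    have h1 : HasDerivAt (fun w : ℝ => (x + w * Complex.I : ℂ)) Complex.I w := by
      simpa using ((Complex.ofRealCLM.hasDerivAt (x := w)).mul_const Complex.I).const_add (x : ℂ)
    have h2 : HasDerivAt (fun w : ℝ => Real.exp (-w ^ 2)) (Real.exp (-w ^ 2) * (-(2 * w))) w := by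
      simpa using ((hasDerivAt_pow 2 w).neg).exp
    refine ((h1.pow n).mul h2.ofReal_comp).congr_deriv ?_
    push_cast
    simp only [Pi.pow_apply]
    linear_combination (-2 * w * (x + w * Complex.I : ℂ) ^ n * Complex.exp (-(w : ℂ) ^ 2)) *
      Complex.I_sq
  have i1 := (integrable_pow_mul_gaussian x (n + 1)).const_mul (2 * Complex.I)
  have i2 := (integrable_pow_mul_gaussian x n).const_mul (2 * Complex.I * x)
  have i3 := (integrable_pow_mul_gaussian x (n - 1)).const_mul (n * Complex.I)
  have h0 := integral_eq_zero_of_hasDerivAt_of_integrable hd ((i1.sub i2).add i3)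
    (integrable_pow_mul_gaussian x n)
  have i12 : Integrable (fun w : ℝ =>
      2 * Complex.I * ((x + w * Complex.I : ℂ) ^ (n + 1) * (Real.exp (-w ^ 2) : ℂ)) -
        2 * Complex.I * x * ((x + w * Complex.I : ℂ) ^ n * (Real.exp (-w ^ 2) : ℂ))) := i1.sub i2
  rw [integral_add i12 i3, integral_sub i1 i2] at h0
  simp only [integral_const_mul] at h0
  refine mul_left_cancel₀ (mul_ne_zero two_ne_zero Complex.I_ne_zero) ?_
  linear_combination h0

lemma integral_pow_mul_gaussian (x : ℝ) (n : ℕ) :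
    ∫ w : ℝ, (x + w * Complex.I : ℂ) ^ n * (Real.exp (-w ^ 2) : ℂ) =
      ((Real.sqrt Real.pi * hermiteH n x / 2 ^ n : ℝ) : ℂ) := by
  have h0 : ∫ w : ℝ, (x + w * Complex.I : ℂ) ^ 0 * (Real.exp (-w ^ 2) : ℂ) =
      ((Real.sqrt Real.pi : ℝ) : ℂ) := by
    simp only [pow_zero, one_mul, integral_complex_ofReal]
    simpa using integral_gaussian 1
  induction n using Nat.twoStepInduction with
  | zero => simpa [hermiteH] using h0
  | one =>
    rw [integral_pow_succ_mul_gaussian, h0]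
    simp [hermiteH]
    ring
  | more n ih1 ih2 =>
    rw [integral_pow_succ_mul_gaussian, ih2, Nat.add_sub_cancel, ih1]
    simp only [hermiteH]
    push_cast
    field_simp
    ring

/-! ### Mehler's formula -/

lemma integral_cexp_neg_sq_add (c d : ℂ) :
    ∫ v : ℝ, Complex.exp (c * v + d) * (Real.exp (-v ^ 2) : ℂ) =
      Real.sqrt Real.pi * Complex.exp (d + c ^ 2 / 4) := by
  have h := integral_cexp_quadratic (b := -1) (by simp) c d
  rw [neg_neg, div_one] at h
  have hs : (Real.pi : ℂ) ^ (1 / 2 : ℂ) = (Real.sqrt Real.pi : ℝ) := by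
    rw [Real.sqrt_eq_rpow, Complex.ofReal_cpow Real.pi_pos.le]; norm_num
  rw [hs] at h
  convert h using 2
  · ext v
    push_cast
    rw [← Complex.exp_add]; ring_nf
  · congr 1; ring

/-- The double Gaussian integral behind Mehler's formula. -/
lemma integral_integral_cexp_mul (x y : ℝ) {r : ℝ} (h0 : 0 < r) (h1 : r < 1) :
    ∫ w : ℝ, ∫ v : ℝ, Complex.exp (2 * r * (x + w * Complex.I) * (y + v * Complex.I)) *
        ((Real.exp (-w ^ 2) : ℂ) * (Real.exp (-v ^ 2) : ℂ)) =
      ((Real.pi / Real.sqrt (1 - r ^ 2) *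
        Real.exp ((2 * r * x * y - r ^ 2 * (x ^ 2 + y ^ 2)) / (1 - r ^ 2)) : ℝ) : ℂ) := by
  have hr : 0 < 1 - r ^ 2 := by nlinarith
  have hrC : (1 - (r : ℂ) ^ 2) ≠ 0 := by exact_mod_cast hr.ne'
  have hin (w : ℝ) : ∫ v : ℝ, Complex.exp (2 * r * (x + w * Complex.I) * (y + v * Complex.I)) *
        ((Real.exp (-w ^ 2) : ℂ) * (Real.exp (-v ^ 2) : ℂ)) =
      Real.sqrt Real.pi * Complex.exp ((-(1 - r ^ 2) : ℂ) * w ^ 2 +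
        (2 * r * Complex.I * (y - r * x)) * w + (2 * r * x * y - r ^ 2 * x ^ 2)) := by
    have := integral_cexp_neg_sq_add (2 * r * (x + w * Complex.I) * Complex.I)
      (2 * r * (x + w * Complex.I) * y)
    calc _ = (Real.exp (-w ^ 2) : ℂ) * ∫ v : ℝ, Complex.exp
          (2 * r * (x + w * Complex.I) * Complex.I * v + 2 * r * (x + w * Complex.I) * y) *
          (Real.exp (-v ^ 2) : ℂ) := by
          rw [← integral_const_mul]
          congr 1; ext v
          ring_nf
      _ = _ := by
          rw [this]
          push_cast
          rw [mul_left_comm, ← Complex.exp_add]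
          congr 2
          linear_combination (r ^ 2 * (x ^ 2 + w ^ 2 * Complex.I ^ 2 - w ^ 2
            + 2 * x * w * Complex.I)) * Complex.I_sq
  simp_rw [hin]
  rw [integral_const_mul, integral_cexp_quadratic]
  swap
  · rw [show (-(1 - r ^ 2) : ℂ) = ((-(1 - r ^ 2) : ℝ) : ℂ) by push_cast; ring, Complex.ofReal_re]
    linarith
  have hs : ((Real.pi : ℂ) / -(-(1 - r ^ 2))) ^ (1 / 2 : ℂ) =
      (Real.sqrt Real.pi / Real.sqrt (1 - r ^ 2) : ℝ) := by
    rw [← Real.sqrt_div Real.pi_pos.le, Real.sqrt_eq_rpow,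
      Complex.ofReal_cpow (div_pos Real.pi_pos hr).le]
    norm_num
  rw [hs, ← mul_assoc]
  have hpi : ((Real.sqrt Real.pi : ℝ) : ℂ) * ((Real.sqrt Real.pi / Real.sqrt (1 - r ^ 2) : ℝ) : ℂ)
      = ((Real.pi / Real.sqrt (1 - r ^ 2) : ℝ) : ℂ) := by
    rw [← Complex.ofReal_mul, ← mul_div_assoc, Real.mul_self_sqrt Real.pi_pos.le]
  rw [hpi, Complex.ofReal_mul, Complex.ofReal_exp]
  congr 2
  push_cast
  rw [mul_pow, mul_pow, Complex.I_sq]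
  have : (4 * -(1 - (r : ℂ) ^ 2)) ≠ 0 :=
    mul_ne_zero (by norm_num) (neg_ne_zero.2 hrC)
  field_simp
  ring

/-- **Mehler's formula**. -/
theorem hasSum_mehler (x y : ℝ) {r : ℝ} (h0 : 0 < r) (h1 : r < 1) :
    HasSum (fun n : ℕ => r ^ n * (hermiteH n x * hermiteH n y / (2 ^ n * (n.factorial : ℝ))))
      (1 / Real.sqrt (1 - r ^ 2) *
        Real.exp ((2 * r * x * y - r ^ 2 * (x ^ 2 + y ^ 2)) / (1 - r ^ 2))) := by
  let G : ℝ × ℝ → ℂ := fun p => (Real.exp (-p.1 ^ 2) : ℂ) * (Real.exp (-p.2 ^ 2) : ℂ)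
  let S : ℝ × ℝ → ℂ := fun p => 2 * r * (x + p.1 * Complex.I) * (y + p.2 * Complex.I)
  let F : ℕ → ℝ × ℝ → ℂ := fun n p => S p ^ n / n.factorial * G p
  have hGn (p) : ‖G p‖ = Real.exp (-p.1 ^ 2) * Real.exp (-p.2 ^ 2) := by
    simp only [G, norm_mul, Complex.norm_real, Real.norm_of_nonneg (Real.exp_nonneg _)]
  have hF (n p) : ‖F n p‖ = ‖S p‖ ^ n / n.factorial * ‖G p‖ := by simp [F]
  have hsum (p) : HasSum (fun n => ‖F n p‖) (Real.exp ‖S p‖ * ‖G p‖) := by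
    simp_rw [hF]
    have := (NormedSpace.expSeries_div_hasSum_exp ‖S p‖).mul_right ‖G p‖
    rwa [← Real.exp_eq_exp_ℝ] at this
  have hdom : Integrable (fun p : ℝ × ℝ => Real.exp ‖S p‖ * ‖G p‖) (volume.prod volume) := by
    have hg : Integrable (fun w : ℝ => Real.exp (-(1 - r) * w ^ 2)) :=
      integrable_exp_neg_mul_sq (by linarith)
    refine ((hg.mul_prod hg).const_mul (Real.exp (r * (x ^ 2 + y ^ 2)))).mono' ?_
      (Eventually.of_forall fun p => ?_)
    · simp only [G, S]; fun_prop
    -- `2 r |x + i w| |y + i v| ≤ r (x ^ 2 + w ^ 2 + y ^ 2 + v ^ 2)`, and `r < 1`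
    have hS : ‖S p‖ ≤ r * (x ^ 2 + p.1 ^ 2 + (y ^ 2 + p.2 ^ 2)) := by
      simp only [S, norm_mul, Complex.norm_real, Real.norm_of_nonneg h0.le, Complex.norm_ofNat]
      rw [← norm_ofReal_add_mul_I_sq, ← norm_ofReal_add_mul_I_sq]
      nlinarith [sq_nonneg (‖(x + p.1 * Complex.I : ℂ)‖ - ‖(y + p.2 * Complex.I : ℂ)‖)]
    rw [Real.norm_of_nonneg (by positivity), hGn, ← Real.exp_add, ← Real.exp_add,
      ← Real.exp_add, ← Real.exp_add]
    apply Real.exp_le_exp.2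
    linarith
  have key : HasSum (fun n => ∫ p, F n p ∂(volume.prod volume))
      (∫ p, Complex.exp (S p) * G p ∂(volume.prod volume)) := by
    refine hasSum_integral_of_dominated_convergence (fun n p => ‖F n p‖) (fun n => ?_)
      (fun n => Eventually.of_forall fun p => le_rfl)
      (Eventually.of_forall fun p => (hsum p).summable) ?_ (Eventually.of_forall fun p => ?_)
    · simp only [F, G, S]; fun_prop
    · simpa only [(hsum _).tsum_eq] using hdom
    · have := (NormedSpace.expSeries_div_hasSum_exp (S p)).mul_right (G p)
      rwa [← Complex.exp_eq_exp_ℂ] at this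
  have hlim : ∫ p, Complex.exp (S p) * G p ∂(volume.prod volume) =
      ((Real.pi / Real.sqrt (1 - r ^ 2) *
        Real.exp ((2 * r * x * y - r ^ 2 * (x ^ 2 + y ^ 2)) / (1 - r ^ 2)) : ℝ) : ℂ) := by
    rw [integral_prod, ← integral_integral_cexp_mul x y h0 h1]
    refine hdom.mono' (by simp only [G, S]; fun_prop) (Eventually.of_forall fun p => ?_)
    rw [norm_mul]
    gcongr
    exact Complex.norm_exp_le_exp_norm _
  have hterm (n : ℕ) : ∫ p, F n p ∂(volume.prod volume) =
      ((Real.pi * (r ^ n * (hermiteH n x * hermiteH n y / (2 ^ n * (n.factorial : ℝ)))) : ℝ) :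
        ℂ) := by
    have : F n = fun p : ℝ × ℝ => ((2 * r : ℂ) ^ n / n.factorial) *
        (((x + p.1 * Complex.I : ℂ) ^ n * (Real.exp (-p.1 ^ 2) : ℂ)) *
        ((y + p.2 * Complex.I : ℂ) ^ n * (Real.exp (-p.2 ^ 2) : ℂ))) := by
      ext p; simp only [F, S, G, mul_pow]; ring
    rw [this, integral_const_mul, integral_prod_mul
      (fun w : ℝ => (x + w * Complex.I : ℂ) ^ n * (Real.exp (-w ^ 2) : ℂ))
      (fun v : ℝ => (y + v * Complex.I : ℂ) ^ n * (Real.exp (-v ^ 2) : ℂ)), integral_pow_mul_gaussian,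
      integral_pow_mul_gaussian]
    have hp : (Real.pi : ℂ) = Real.sqrt Real.pi * Real.sqrt Real.pi := by
      rw [← Complex.ofReal_mul, Real.mul_self_sqrt Real.pi_pos.le]
    push_cast
    rw [hp, mul_pow]
    field_simp
  rw [hlim] at key
  simp_rw [hterm] at key
  have := (Complex.hasSum_ofReal.1 key).mul_left Real.pi⁻¹
  simp only [inv_mul_cancel_left₀ Real.pi_ne_zero] at this
  rwa [← mul_assoc, ← mul_div_assoc, inv_mul_cancel₀ Real.pi_ne_zero] at this

/-! ### The constants -/

lemma sqrt_five_bounds : (2 : ℝ) < Real.sqrt 5 ∧ Real.sqrt 5 < 3 :=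
  ⟨Real.lt_sqrt_of_sq_lt (by norm_num), (Real.sqrt_lt' (by norm_num)).2 (by norm_num)⟩

lemma sqrt_five_sq : Real.sqrt 5 ^ 2 = 5 := Real.sq_sqrt (by norm_num)

lemma a_eq : a = (3 - Real.sqrt 5) / 2 := by
  have := sqrt_five_bounds
  rw [a, div_eq_iff (by linarith)]
  nlinarith [sqrt_five_sq]

lemma a_pos : 0 < a := by rw [a_eq]; linarith [sqrt_five_bounds]

lemma a_lt_half : a < 1 / 2 := by rw [a_eq]; linarith [sqrt_five_bounds]

lemma a_add_c : a + c = 1 := by rw [a_eq, c]; ring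

lemma one_sub_a_sq : 1 - a ^ 2 = a * Real.sqrt 5 := by
  rw [a_eq]; nlinarith [sqrt_five_sq]

lemma b_pos : 0 < b := Real.rpow_pos_of_pos (by norm_num) _

lemma h_pos : 0 < h := Real.rpow_pos_of_pos (by norm_num) _

lemma b_sq : b ^ 2 = h := by
  rw [b, h, ← Real.rpow_natCast, ← Real.rpow_mul (by norm_num)]; norm_num

lemma h_sq : h ^ 2 = Real.sqrt 5 := by
  rw [h, Real.sqrt_eq_rpow, ← Real.rpow_natCast, ← Real.rpow_mul (by norm_num)]; norm_num

lemma b_le_two : b ≤ 2 := by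
  have h1 : h ≤ 4 := by nlinarith [h_sq, sqrt_five_bounds, h_pos]
  nlinarith [b_sq, b_pos]

lemma lam_eq (n : ℕ) : lam n = a ^ n * Real.sqrt a := by
  rw [lam, Real.rpow_add a_pos, Real.rpow_natCast, Real.sqrt_eq_rpow]

lemma lam_pos (n : ℕ) : 0 < lam n := Real.rpow_pos_of_pos a_pos _

lemma sqrt_lam_le (n : ℕ) : Real.sqrt (lam n) ≤ Real.sqrt a ^ n := by
  rw [lam_eq, Real.sqrt_mul (pow_nonneg a_pos.le _), Real.sqrt_eq_iff_mul_self_eq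
    (pow_nonneg a_pos.le _) (pow_nonneg (Real.sqrt_nonneg a) n) |>.2]
  · refine mul_le_of_le_one_right (by positivity) ?_
    rw [Real.sqrt_le_one, Real.sqrt_le_one]
    linarith [a_lt_half]
  · rw [← mul_pow, Real.mul_self_sqrt a_pos.le]

/-- The geometric rate `√(2 a) < 1` at which the terms of the series decay. -/
noncomputable def rate : ℝ := Real.sqrt a * Real.sqrt 2

lemma rate_pos : 0 < rate := mul_pos (Real.sqrt_pos.2 a_pos) (by positivity)

lemma rate_lt_one : rate < 1 := by
  rw [rate, ← Real.sqrt_mul a_pos.le, Real.sqrt_lt' one_pos]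
  linarith [a_lt_half]

/-! ### The Gaussian kernel on the line -/

theorem hasSum_lam_mul_phi_mul_phi (s t : ℝ) :
    HasSum (fun n => lam n * (phi n s * phi n t)) (Real.exp (-(s - t) ^ 2)) := by
  have hm := (hasSum_mehler (h * s) (h * t) a_pos (by linarith [a_lt_half])).mul_left
    (Real.sqrt a * b ^ 2 * Real.exp (-c * s ^ 2 + -c * t ^ 2))
  have h5 : 0 < Real.sqrt 5 := by positivity
  have hconst : Real.sqrt a * b ^ 2 * (1 / Real.sqrt (1 - a ^ 2)) = 1 := by
    have hh : h = Real.sqrt (Real.sqrt 5) := by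
      rw [← h_sq, Real.sqrt_sq h_pos.le]
    rw [one_sub_a_sq, Real.sqrt_mul a_pos.le, b_sq, hh]
    have := Real.sqrt_pos.2 a_pos
    field_simp
  have hexp : -c * s ^ 2 + -c * t ^ 2 +
      (2 * a * (h * s) * (h * t) - a ^ 2 * ((h * s) ^ 2 + (h * t) ^ 2)) / (1 - a ^ 2) =
      -(s - t) ^ 2 := by
    have : (2 * a * (h * s) * (h * t) - a ^ 2 * ((h * s) ^ 2 + (h * t) ^ 2)) / (1 - a ^ 2) =
        2 * s * t - a * (s ^ 2 + t ^ 2) := by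
      rw [one_sub_a_sq, div_eq_iff (mul_pos a_pos h5).ne']
      linear_combination (2 * a * s * t - a ^ 2 * (s ^ 2 + t ^ 2)) * h_sq
    rw [this]
    linear_combination (-(s ^ 2 + t ^ 2)) * a_add_c
  convert! hm using 1
  · ext n
    have hN : Real.sqrt (2 ^ n * (n.factorial : ℝ)) ^ 2 = 2 ^ n * (n.factorial : ℝ) :=
      Real.sq_sqrt (by positivity)
    have hN0 : Real.sqrt (2 ^ n * (n.factorial : ℝ)) ≠ 0 :=
      (Real.sqrt_pos.2 (by positivity)).ne'
    rw [lam_eq, phi, phi, Real.exp_add]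
    generalize Real.sqrt (2 ^ n * (n.factorial : ℝ)) = N at *
    rw [← hN]
    field_simp
  · rw [← hexp, Real.exp_add]
    linear_combination (-(Real.exp (-c * s ^ 2 + -c * t ^ 2) * Real.exp ((2 * a * (h * s) * (h * t) -
      a ^ 2 * ((h * s) ^ 2 + (h * t) ^ 2)) / (1 - a ^ 2)))) * hconst

/-! ### Hermite functions -/

/-- The normalised Hermite functions `H_n(x) exp (-x ^ 2 / 2) / √(2 ^ n n!)`, up to the constant
factor that would make them orthonormal in `L²(ℝ)`. -/
noncomputable def hermiteFun (n : ℕ) (x : ℝ) : ℝ :=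
  hermiteH n x / Real.sqrt (2 ^ n * (n.factorial : ℝ)) * Real.exp (-x ^ 2 / 2)

/-- A single term of the diagonal Mehler series with ratio `1 / 2` is at most its sum. -/
lemma abs_hermiteH_div_le (n : ℕ) (x : ℝ) :
    |hermiteH n x / Real.sqrt (2 ^ n * (n.factorial : ℝ))| ≤
      2 * Real.sqrt 2 ^ n * Real.exp (x ^ 2 / 3) := by
  have hm := hasSum_mehler x x (r := 1 / 2) (by norm_num) (by norm_num)
  have h1 := le_hasSum hm n fun i _ =>
    mul_nonneg (by positivity) (div_nonneg (mul_self_nonneg _) (by positivity))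
  have hs : 1 / Real.sqrt (1 - (1 / 2 : ℝ) ^ 2) ≤ 4 := by
    rw [div_le_iff₀ (Real.sqrt_pos.2 (by norm_num))]
    have : (1 / 2 : ℝ) ≤ Real.sqrt (1 - (1 / 2 : ℝ) ^ 2) := Real.le_sqrt_of_sq_le (by norm_num)
    linarith
  have he : (2 * (1 / 2) * x * x - (1 / 2 : ℝ) ^ 2 * (x ^ 2 + x ^ 2)) / (1 - (1 / 2) ^ 2) =
      x ^ 2 / 3 + x ^ 2 / 3 := by ring
  rw [he, Real.exp_add] at h1
  refine abs_le_of_sq_le_sq ?_ (by positivity)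
  rw [div_pow, Real.sq_sqrt (by positivity), mul_pow, mul_pow, ← pow_mul, mul_comm n 2, pow_mul,
    Real.sq_sqrt zero_le_two]
  have h2 : (1 / 2 : ℝ) ^ n * (hermiteH n x * hermiteH n x / (2 ^ n * (n.factorial : ℝ))) ≤
      4 * (Real.exp (x ^ 2 / 3) * Real.exp (x ^ 2 / 3)) := h1.trans (by gcongr)
  have h3 := mul_le_mul_of_nonneg_left h2 (show (0 : ℝ) ≤ 2 ^ n by positivity)
  rw [← mul_assoc, ← mul_pow] at h3
  norm_num at h3
  rw [sq (hermiteH n x)]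
  linarith

lemma abs_hermiteFun_le (n : ℕ) (x : ℝ) : |hermiteFun n x| ≤ 2 * Real.sqrt 2 ^ n := by
  rw [hermiteFun, abs_mul, abs_of_pos (Real.exp_pos _)]
  calc _ ≤ 2 * Real.sqrt 2 ^ n * Real.exp (x ^ 2 / 3) * Real.exp (-x ^ 2 / 2) := by
        gcongr; exact abs_hermiteH_div_le n x
    _ = 2 * Real.sqrt 2 ^ n * Real.exp (-x ^ 2 / 6) := by
        rw [mul_assoc, ← Real.exp_add]; ring_nf
    _ ≤ 2 * Real.sqrt 2 ^ n * 1 := by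
        gcongr; exact Real.exp_le_one_iff.2 (by nlinarith [sq_nonneg x])
    _ = _ := mul_one _

lemma hasDerivAt_hermiteH (n : ℕ) (x : ℝ) :
    HasDerivAt (hermiteH n) (2 * n * hermiteH (n - 1) x) x := by
  induction n using Nat.twoStepInduction with
  | zero => simpa [hermiteH] using hasDerivAt_const x (1 : ℝ)
  | one => simpa [hermiteH] using (hasDerivAt_id x).const_mul 2
  | more n ih1 ih2 =>
    have h1 := ((((hasDerivAt_id x).const_mul 2).mul ih2).sub
      (ih1.const_mul (2 * ((n : ℝ) + 1))))
    refine h1.congr_deriv ?_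
    cases n with
    | zero => simp [hermiteH]; ring
    | succ n =>
      have hrec : hermiteH (n + 1 + 1) x =
        2 * x * hermiteH (n + 1) x - 2 * ((n : ℝ) + 1) * hermiteH n x := rfl
      simp only [Nat.add_sub_cancel, id]
      rw [show n + 1 + 2 - 1 = n + 1 + 1 by lia]
      push_cast
      linear_combination (-(2 * n + 4) : ℝ) * hrec

lemma contDiff_hermiteH {N : WithTop ℕ∞} (n : ℕ) : ContDiff ℝ N (hermiteH n) := by
  induction n using Nat.twoStepInduction with
  | zero => exact contDiff_const
  | one => exact contDiff_const.mul contDiff_id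
  | more n ih1 ih2 =>
    exact ((contDiff_const.mul contDiff_id).mul ih2).sub (contDiff_const.mul ih1)

lemma contDiff_hermiteFun {N : WithTop ℕ∞} (n : ℕ) : ContDiff ℝ N (hermiteFun n) := by
  have := contDiff_hermiteH (N := N) n
  unfold hermiteFun
  fun_prop

lemma sqrt_two_pow_mul_factorial_succ (n : ℕ) :
    Real.sqrt (2 ^ (n + 1) * ((n + 1).factorial : ℝ)) =
      Real.sqrt (2 * (n + 1)) * Real.sqrt (2 ^ n * (n.factorial : ℝ)) := by
  rw [← Real.sqrt_mul (by positivity), Nat.factorial_succ]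
  push_cast
  ring_nf

/-- The ladder relation of the Hermite functions; for `n = 0` the first term vanishes. -/
lemma deriv_hermiteFun (n : ℕ) :
    deriv (hermiteFun n) = fun x => Real.sqrt (2 * n) / 2 * hermiteFun (n - 1) x -
      Real.sqrt (2 * (n + 1)) / 2 * hermiteFun (n + 1) x := by
  ext x
  have he : HasDerivAt (fun x : ℝ => Real.exp (-x ^ 2 / 2)) (Real.exp (-x ^ 2 / 2) * (-x)) x := by
    refine (((hasDerivAt_pow 2 x).neg.div_const 2).exp).congr_deriv ?_
    simp only [Pi.neg_apply]; push_cast; ring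
  have hd := ((hasDerivAt_hermiteH n x).div_const
    (Real.sqrt (2 ^ n * (n.factorial : ℝ)))).mul he
  refine (hd.congr_deriv ?_).deriv
  have hN (n : ℕ) : Real.sqrt (2 ^ n * (n.factorial : ℝ)) ≠ 0 :=
    (Real.sqrt_pos.2 (by positivity)).ne'
  have hS (n : ℕ) : Real.sqrt (2 * ((n : ℝ) + 1)) ≠ 0 := (Real.sqrt_pos.2 (by positivity)).ne'
  have hS2 (n : ℕ) : Real.sqrt (2 * ((n : ℝ) + 1)) ^ 2 = 2 * ((n : ℝ) + 1) :=
    Real.sq_sqrt (by positivity)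
  cases n with
  | zero =>
    have h2 : Real.sqrt 2 ≠ 0 := by positivity
    simp [hermiteFun, hermiteH]
    field_simp
  | succ m =>
    have h0 := hN m
    have h1 := hS m
    have h2 := hS (m + 1)
    have h3 := hS2 m
    simp only [hermiteFun, Nat.add_sub_cancel, sqrt_two_pow_mul_factorial_succ]
    simp only [hermiteH]
    push_cast at h2 ⊢
    field_simp
    rw [h3]
    ring

lemma exists_abs_iteratedDeriv_hermiteFun_le (k : ℕ) :
    ∃ C : ℝ, 0 ≤ C ∧ ∀ n x, |iteratedDeriv k (hermiteFun n) x| ≤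
      C * ((n : ℝ) + 1) ^ k * Real.sqrt 2 ^ n := by
  induction k with
  | zero =>
    refine ⟨2, by norm_num, fun n x => ?_⟩
    simpa using abs_hermiteFun_le n x
  | succ k ih =>
    obtain ⟨C, hC, hb⟩ := ih
    refine ⟨C * (1 + 2 ^ k * 2), by positivity, fun n x => ?_⟩
    have hcd (m : ℕ) : ContDiffAt ℝ k (hermiteFun m) x := (contDiff_hermiteFun m).contDiffAt
    have hf (r : ℝ) (m : ℕ) : ContDiffAt ℝ k (fun x => r * hermiteFun m x) x :=
      contDiffAt_const.mul (hcd m)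
    rw [iteratedDeriv_succ', deriv_hermiteFun, iteratedDeriv_fun_sub (hf _ _) (hf _ _),
      iteratedDeriv_const_mul_field, iteratedDeriv_const_mul_field]
    have hs (m : ℕ) : Real.sqrt (2 * (m : ℝ)) / 2 ≤ m := by
      rw [div_le_iff₀ two_pos, Real.sqrt_le_left (by positivity)]
      rcases Nat.eq_zero_or_pos m with rfl | hm
      · simp
      · have : (1 : ℝ) ≤ m := by exact_mod_cast hm
        nlinarith
    have hs0 := (hs n).trans (show (n : ℝ) ≤ n + 1 by linarith)
    have hs1 := hs (n + 1)
    push_cast at hs1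
    have hr1 : (1 : ℝ) ≤ Real.sqrt 2 := Real.one_le_sqrt.2 one_le_two
    have hr2 : Real.sqrt 2 ≤ 2 := by
      rw [Real.sqrt_le_left (by norm_num)]; norm_num
    have hb0 : |iteratedDeriv k (hermiteFun (n - 1)) x| ≤
        C * ((n : ℝ) + 1) ^ k * Real.sqrt 2 ^ n := by
      refine (hb _ _).trans ?_
      have : ((n - 1 : ℕ) : ℝ) ≤ n := by exact_mod_cast n.sub_le 1
      gcongr
      exact n.sub_le 1
    have hb1 : |iteratedDeriv k (hermiteFun (n + 1)) x| ≤
        C * (2 ^ k * ((n : ℝ) + 1) ^ k) * (Real.sqrt 2 ^ n * 2) := by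
      refine (hb _ _).trans ?_
      rw [← mul_pow, pow_succ (Real.sqrt 2)]
      push_cast
      gcongr
      linarith [(Nat.cast_nonneg n : (0 : ℝ) ≤ n)]
    calc _ ≤ |Real.sqrt (2 * n) / 2 * iteratedDeriv k (hermiteFun (n - 1)) x| +
          |Real.sqrt (2 * (n + 1)) / 2 * iteratedDeriv k (hermiteFun (n + 1)) x| := abs_sub _ _
      _ ≤ ((n : ℝ) + 1) * (C * ((n : ℝ) + 1) ^ k * Real.sqrt 2 ^ n) +
          ((n : ℝ) + 1) * (C * (2 ^ k * ((n : ℝ) + 1) ^ k) * (Real.sqrt 2 ^ n * 2)) := by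
          rw [abs_mul, abs_mul, abs_of_nonneg (a := Real.sqrt (2 * n) / 2) (by positivity),
            abs_of_nonneg (a := Real.sqrt (2 * (n + 1)) / 2) (by positivity)]
          gcongr
      _ = _ := by ring

/-! ### Bounds for the weighted eigenfunctions -/

/-- Since `√5 / 3 - c = a / 3`, the terms grow strictly slower than `exp (t ^ 2 / 2)`, which is what
square integrability against `γ` requires. -/
lemma abs_sqrt_lam_mul_phi_le (n : ℕ) (t : ℝ) :
    |Real.sqrt (lam n) * phi n t| ≤ 4 * rate ^ n * Real.exp (a / 3 * t ^ 2) := by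
  have h1 := abs_hermiteH_div_le n (h * t)
  have h2 : phi n t = b * Real.exp (-c * t ^ 2) *
      (hermiteH n (h * t) / Real.sqrt (2 ^ n * (n.factorial : ℝ))) := by
    rw [phi]; ring
  rw [h2, abs_mul, abs_mul, abs_mul, abs_of_nonneg (Real.sqrt_nonneg _), abs_of_pos b_pos,
    abs_of_pos (Real.exp_pos _)]
  calc _ ≤ Real.sqrt a ^ n * (2 * Real.exp (-c * t ^ 2) *
        (2 * Real.sqrt 2 ^ n * Real.exp ((h * t) ^ 2 / 3))) := by
        have := b_pos
        gcongr
        · exact sqrt_lam_le n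
        · exact b_le_two
    _ = 4 * rate ^ n * (Real.exp (-c * t ^ 2) * Real.exp ((h * t) ^ 2 / 3)) := by
        rw [rate, mul_pow]; ring
    _ = _ := by
        rw [← Real.exp_add, mul_pow, h_sq, a_eq, c]
        ring_nf

/-- Multiplied by `exp (-t ^ 2 / 2)`, the eigenfunctions become dilated Hermite functions. -/
lemma sqrt_lam_mul_phi_mul_exp (n : ℕ) (t : ℝ) :
    Real.sqrt (lam n) * phi n t * Real.exp (-t ^ 2 / 2) =
      Real.sqrt (lam n) * b * hermiteFun n (h * t) := by
  have : Real.exp (-(h * t) ^ 2 / 2) = Real.exp (-c * t ^ 2) * Real.exp (-t ^ 2 / 2) := by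
    rw [← Real.exp_add, mul_pow, h_sq, c]; ring_nf
  rw [phi, hermiteFun, this]
  ring

/-- The derivatives of order `k` of the damped eigenfunctions are `O((n + 1) ^ k ρ ^ n)`, uniformly on
the line. -/
lemma exists_norm_iteratedFDeriv_le (k : ℕ) :
    ∃ C : ℝ, 0 ≤ C ∧ ∀ n x, ‖iteratedFDeriv ℝ k
      (fun t => Real.sqrt (lam n) * phi n t * Real.exp (-t ^ 2 / 2)) x‖ ≤
      C * (((n : ℝ) + 1) ^ k * rate ^ n) := by
  obtain ⟨C, hC, hb⟩ := exists_abs_iteratedDeriv_hermiteFun_le k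
  have := h_pos
  refine ⟨2 * h ^ k * C, by positivity, fun n x => ?_⟩
  simp_rw [sqrt_lam_mul_phi_mul_exp]
  rw [norm_iteratedFDeriv_eq_norm_iteratedDeriv, iteratedDeriv_const_mul_field,
    iteratedDeriv_comp_const_mul (contDiff_hermiteFun n), Real.norm_eq_abs, abs_mul, abs_mul,
    abs_mul, abs_of_nonneg (Real.sqrt_nonneg _), abs_of_pos b_pos, abs_of_pos (pow_pos this k)]
  calc _ ≤ Real.sqrt a ^ n * 2 * (h ^ k * (C * ((n : ℝ) + 1) ^ k * Real.sqrt 2 ^ n)) := by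
        have := b_pos
        gcongr
        · exact sqrt_lam_le n
        · exact b_le_two
        · exact hb _ _
    _ = _ := by rw [rate, mul_pow]; ring

/-! ### Series of independent Gaussian variables -/

section GaussianSeries

variable {Ω ι : Type*} [MeasurableSpace Ω] {P : Measure Ω} {Z : ι → Ω → ℝ}

/-- An almost surely convergent linear combination of independent standard Gaussian variables is
Gaussian: the characteristic functions of the partial sums converge by dominated convergence. -/
theorem hasLaw_gaussianReal_of_hasSum [Countable ι] [IsProbabilityMeasure P]
    (hlaw : ∀ q, HasLaw (Z q) (gaussianReal 0 1) P) (hindep : iIndepFun Z P)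
    {e : ι → ℝ} {v : NNReal} (hv : HasSum (fun q => e q ^ 2) (v : ℝ)) {S : Ω → ℝ}
    (hS : ∀ᵐ ω ∂P, HasSum (fun q => Z q ω * e q) (S ω)) :
    HasLaw S (gaussianReal 0 v) P := by
  have hlaw' (q : ι) := gaussianReal_mul_const (hlaw q) (e q)
  have hm (q : ι) : AEMeasurable (fun ω => Z q ω * e q) P := (hlaw' q).aemeasurable
  have hpm (s : Finset ι) : AEMeasurable (fun ω => ∑ q ∈ s, Z q ω * e q) P :=
    s.aemeasurable_fun_sum fun q _ => hm q
  have hSm : AEMeasurable S P := aemeasurable_of_tendsto_metrizable_ae atTop hpm hS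
  have hind : iIndepFun (fun q ω => Z q ω * e q) P :=
    hindep.comp (fun q x => x * e q) fun q => by fun_prop
  refine ⟨hSm, ?_⟩
  have : IsProbabilityMeasure (P.map S) := Measure.isProbabilityMeasure_map hSm
  refine Measure.ext_of_charFun (funext fun t => ?_)
  have hcf (X : Ω → ℝ) (hX : AEMeasurable X P) :
      charFun (P.map X) t = ∫ ω, Complex.exp (t * X ω * Complex.I) ∂P := by
    rw [charFun_apply_real, integral_map hX (by fun_prop)]
  have hpart (s : Finset ι) : charFun (P.map fun ω => ∑ q ∈ s, Z q ω * e q) t =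
      Complex.exp (-(((∑ q ∈ s, e q ^ 2 : ℝ)) * t ^ 2 / 2 : ℂ)) := by
    rw [iIndepFun.charFun_map_fun_finsetSum_eq_prod (fun q _ => hm q)
      (hind.precomp (g := ((↑) : s → ι)) Subtype.val_injective), Finset.prod_apply]
    have h1 (q : ι) : charFun (P.map fun ω => Z q ω * e q) t =
        Complex.exp (-((e q ^ 2 : ℝ) * t ^ 2 / 2 : ℂ)) := by
      rw [(hlaw' q).map_eq, charFun_gaussianReal]
      congr 1
      simp
    simp_rw [h1]
    rw [← Complex.exp_sum]
    push_cast
    rw [Finset.sum_neg_distrib, Finset.sum_mul, Finset.sum_div]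
  have hl1 : Tendsto (fun s : Finset ι => charFun (P.map fun ω => ∑ q ∈ s, Z q ω * e q) t) atTop
      (𝓝 (charFun (P.map S) t)) := by
    rw [hcf S hSm]
    simp_rw [fun s => hcf _ (hpm s)]
    refine tendsto_integral_filter_of_dominated_convergence (fun _ => 1)
      (Eventually.of_forall fun s => ?_) (Eventually.of_forall fun s => ?_)
      (integrable_const _) ?_
    · have := hpm s
      exact (by fun_prop : AEMeasurable _ P).aestronglyMeasurable
    · refine Eventually.of_forall fun ω => ?_
      rw [← Complex.ofReal_mul, Complex.norm_exp_ofReal_mul_I]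
    · filter_upwards [hS] with ω hω
      have hc : Continuous fun x : ℝ => Complex.exp (t * x * Complex.I) := by fun_prop
      exact (hc.tendsto _).comp hω
  have hl2 : Tendsto (fun s : Finset ι => charFun (P.map fun ω => ∑ q ∈ s, Z q ω * e q) t) atTop
      (𝓝 (charFun (gaussianReal 0 v) t)) := by
    simp_rw [hpart]
    rw [charFun_gaussianReal]
    have hc : Continuous fun x : ℝ => Complex.exp (-(x * t ^ 2 / 2 : ℂ)) := by fun_prop
    have hexp : (t * (0 : ℝ) * Complex.I - ((v : ℝ) : ℂ) * t ^ 2 / 2 : ℂ) =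
        -(((v : ℝ) : ℂ) * t ^ 2 / 2) := by push_cast; ring
    rw [hexp]
    exact (hc.tendsto _).comp hv
  exact tendsto_nhds_unique hl1 hl2

/-- If `∑ w q < ∞` then `∑ E |Z q| w q < ∞`, so `∑ |Z q| w q` is almost surely finite. -/
theorem ae_summable_abs_mul [Countable ι] (hlaw : ∀ q, HasLaw (Z q) (gaussianReal 0 1) P)
    {w : ι → ℝ} (hw0 : ∀ q, 0 ≤ w q) (hw : Summable w) :
    ∀ᵐ ω ∂P, Summable fun q => |Z q ω| * w q := by
  have hm (q : ι) : AEMeasurable (Z q) P := (hlaw q).aemeasurable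
  have hfin : ∫⁻ x, ‖x‖ₑ ∂(gaussianReal 0 1) ≠ ∞ :=
    (((memLp_id_gaussianReal (μ := 0) (v := 1) 1).integrable (by simp)).2).ne
  have hterm (q : ι) : ∫⁻ ω, ‖Z q ω * w q‖ₑ ∂P =
      (∫⁻ x, ‖x‖ₑ ∂(gaussianReal 0 1)) * ENNReal.ofReal (w q) := by
    simp_rw [enorm_mul]
    rw [lintegral_mul_const'' _ (hm q).enorm, Real.enorm_of_nonneg (hw0 q),
      (hlaw q).lintegral_comp (f := fun x => ‖x‖ₑ) (by fun_prop)]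
  have hsum : ∫⁻ ω, ∑' q, ‖Z q ω * w q‖ₑ ∂P ≠ ∞ := by
    rw [lintegral_tsum fun q => ((hm q).mul_const _).enorm]
    simp_rw [hterm]
    rw [ENNReal.tsum_mul_left]
    exact ENNReal.mul_ne_top hfin hw.tsum_ofReal_ne_top
  filter_upwards [ae_lt_top' (AEMeasurable.tsum fun q => ((hm q).mul_const _).enorm) hsum]
    with ω hω
  have := ENNReal.summable_toReal hω.ne
  simpa [abs_of_nonneg (hw0 _)] using this

lemma integral_sq_of_hasLaw_gaussianReal {X : Ω → ℝ} {v : NNReal}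
    (hX : HasLaw X (gaussianReal 0 v) P) :
    Integrable (fun ω => X ω ^ 2) P ∧ ∫ ω, X ω ^ 2 ∂P = v := by
  have h1 : Integrable (fun x : ℝ => x ^ 2) (gaussianReal 0 v) :=
    (memLp_id_gaussianReal (μ := 0) (v := v) 2).integrable_sq
  constructor
  · exact (hX.map_eq ▸ h1).comp_aemeasurable hX.aemeasurable
  · have h2 := hX.integral_comp (f := fun x : ℝ => x ^ 2) (by fun_prop)
    have h3 := variance_fun_id_gaussianReal (μ := 0) (v := v)
    rw [variance_of_integral_eq_zero (by fun_prop) integral_id_gaussianReal] at h3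
    rw [← h3]
    exact h2

end GaussianSeries

/-! ### The eigenfunctions on three-dimensional space -/

/-- The eigenfunction `φ_n` scaled by the square root of its eigenvalue. -/
noncomputable def scaledPhi (n : ℕ) (t : ℝ) : ℝ := Real.sqrt (lam n) * phi n t

lemma sqrt_tau_mul_psi (q : ℕ × ℕ × ℕ) (x : E3) :
    Real.sqrt (tau q) * psi q x =
      scaledPhi q.1 (x 0) * (scaledPhi q.2.1 (x 1) * scaledPhi q.2.2 (x 2)) := by
  rw [tau, psi, Real.sqrt_mul (mul_pos (lam_pos _) (lam_pos _)).le, Real.sqrt_mul (lam_pos _).le]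
  simp only [scaledPhi]
  ring

lemma norm_sq_E3 (x : E3) : ‖x‖ ^ 2 = x 0 ^ 2 + x 1 ^ 2 + x 2 ^ 2 := by
  rw [EuclideanSpace.real_norm_sq_eq, Fin.sum_univ_three]

lemma hasSum_scaledPhi (s t : ℝ) :
    HasSum (fun n => scaledPhi n s * scaledPhi n t) (Real.exp (-(s - t) ^ 2)) := by
  convert! hasSum_lam_mul_phi_mul_phi s t using 2 with n
  have := Real.mul_self_sqrt (lam_pos n).le
  simp only [scaledPhi]
  linear_combination (phi n s * phi n t) * this

lemma hasSum_mul_mul {f g k : ℕ → ℝ} {r s t : ℝ} (hf : HasSum f r) (hg : HasSum g s)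
    (hk : HasSum k t) :
    HasSum (fun q : ℕ × ℕ × ℕ => f q.1 * (g q.2.1 * k q.2.2)) (r * (s * t)) := by
  have hgk := hg.mul hk (summable_mul_of_summable_norm hg.summable.norm hk.summable.norm)
  exact hf.mul hgk (summable_mul_of_summable_norm hf.summable.norm hgk.summable.norm)

theorem hasSum_kernel (x y : E3) :
    HasSum (fun q => (Real.sqrt (tau q) * psi q x) * (Real.sqrt (tau q) * psi q y))
      (kernel x y) := by
  have hk : kernel x y = Real.exp (-(x 0 - y 0) ^ 2) *
      (Real.exp (-(x 1 - y 1) ^ 2) * Real.exp (-(x 2 - y 2) ^ 2)) := by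
    rw [kernel, norm_sq_E3, ← Real.exp_add, ← Real.exp_add]
    simp only [PiLp.sub_apply]
    ring_nf
  rw [hk]
  refine (hasSum_mul_mul (hasSum_scaledPhi (x 0) (y 0)) (hasSum_scaledPhi (x 1) (y 1))
    (hasSum_scaledPhi (x 2) (y 2))).congr_fun fun q => ?_
  rw [sqrt_tau_mul_psi, sqrt_tau_mul_psi]
  ring

/-- The polynomially weighted geometric sequence `(n + 1) ^ k ρ ^ n`, which controls the
derivatives of order `k`. -/
noncomputable def geomWeight (k n : ℕ) : ℝ := ((n : ℝ) + 1) ^ k * rate ^ n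

/-- The product of the weights `geomWeight k` over a triple of indices. -/
noncomputable def weight (k : ℕ) (q : ℕ × ℕ × ℕ) : ℝ :=
  geomWeight k q.1 * (geomWeight k q.2.1 * geomWeight k q.2.2)

lemma geomWeight_nonneg (k n : ℕ) : 0 ≤ geomWeight k n := by
  have := rate_pos
  unfold geomWeight
  positivity

lemma weight_nonneg (k : ℕ) (q : ℕ × ℕ × ℕ) : 0 ≤ weight k q :=
  mul_nonneg (geomWeight_nonneg _ _) (mul_nonneg (geomWeight_nonneg _ _) (geomWeight_nonneg _ _))

lemma geomWeight_mono (n : ℕ) : Monotone fun k => geomWeight k n := fun i j hij => by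
  have := rate_pos
  change ((n : ℝ) + 1) ^ i * rate ^ n ≤ ((n : ℝ) + 1) ^ j * rate ^ n
  gcongr
  linarith [(Nat.cast_nonneg n : (0 : ℝ) ≤ n)]

lemma summable_geomWeight (k : ℕ) : Summable (geomWeight k) := by
  have h1 : Summable fun n : ℕ => (n : ℝ) ^ k * rate ^ n :=
    summable_pow_mul_geometric_of_norm_lt_one k
      (by rw [Real.norm_of_nonneg rate_pos.le]; exact rate_lt_one)
  have h2 := ((summable_nat_add_iff 1).2 h1).mul_left rate⁻¹
  refine h2.congr fun n => ?_
  have := rate_pos.ne'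
  rw [geomWeight, pow_succ]
  push_cast
  field_simp

lemma summable_weight (k : ℕ) : Summable (weight k) := by
  have h0 := summable_geomWeight k
  exact h0.mul_of_nonneg (h0.mul_of_nonneg h0 (geomWeight_nonneg k) (geomWeight_nonneg k))
    (geomWeight_nonneg k) fun q => mul_nonneg (geomWeight_nonneg k _) (geomWeight_nonneg k _)

lemma abs_sqrt_tau_mul_psi_le (q : ℕ × ℕ × ℕ) (x : E3) :
    |Real.sqrt (tau q) * psi q x| ≤ 64 * weight 0 q * Real.exp (a / 3 * ‖x‖ ^ 2) := by
  have hb (n : ℕ) (t : ℝ) : |scaledPhi n t| ≤ 4 * geomWeight 0 n * Real.exp (a / 3 * t ^ 2) := by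
    rw [geomWeight, pow_zero, one_mul]
    exact abs_sqrt_lam_mul_phi_le n t
  have hg (n : ℕ) := geomWeight_nonneg 0 n
  rw [sqrt_tau_mul_psi, abs_mul, abs_mul]
  calc _ ≤ (4 * geomWeight 0 q.1 * Real.exp (a / 3 * x 0 ^ 2)) *
        ((4 * geomWeight 0 q.2.1 * Real.exp (a / 3 * x 1 ^ 2)) *
          (4 * geomWeight 0 q.2.2 * Real.exp (a / 3 * x 2 ^ 2))) := by
        have := hg q.1
        have := hg q.2.1
        gcongr <;> exact hb _ _
    _ = _ := by
        rw [norm_sq_E3, mul_add, mul_add, Real.exp_add, Real.exp_add, weight]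
        ring

instance : IsFiniteMeasure gammaMeasure := by
  refine isFiniteMeasure_withDensity_ofReal ?_
  have := (integrable_exp_neg_mul_sq (b := 1) one_pos).const_mul (1 / Real.sqrt Real.pi)
  simpa using this.2

lemma integrable_exp_mul_sq_gammaMeasure {r : ℝ} (hr : r < 1) :
    Integrable (fun t => Real.exp (r * t ^ 2)) gammaMeasure := by
  rw [gammaMeasure, integrable_withDensity_iff (by fun_prop)
    (Eventually.of_forall fun _ => ENNReal.ofReal_lt_top)]
  have := (integrable_exp_neg_mul_sq (b := 1 - r) (by linarith)).const_mul (1 / Real.sqrt Real.pi)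
  refine this.congr (Eventually.of_forall fun t => ?_)
  simp only []
  rw [ENNReal.toReal_ofReal (by positivity), mul_left_comm, ← Real.exp_add]
  ring_nf

lemma memLp_exp_mul_norm_sq_theta {r : ℝ} (hr : 2 * r < 1) :
    MemLp (fun x : E3 => Real.exp (r * ‖x‖ ^ 2)) 2 theta := by
  have hc : Continuous fun x : E3 => Real.exp (r * ‖x‖ ^ 2) := by fun_prop
  rw [memLp_two_iff_integrable_sq hc.aestronglyMeasurable, theta,
    integrable_map_measure (by fun_prop) (by fun_prop)]
  refine (Integrable.fintype_prod (μ := fun _ : Fin 3 => gammaMeasure)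
    fun _ => integrable_exp_mul_sq_gammaMeasure hr).congr (Eventually.of_forall fun x => ?_)
  simp only [Fin.prod_univ_three, Function.comp_apply, norm_sq_E3]
  rw [← Real.exp_add, ← Real.exp_add, ← Real.exp_nat_mul]
  congr 1
  push_cast
  ring

/-! ### Derivatives of the terms -/

section Smooth

variable {E ι κ : Type*} [NormedAddCommGroup E] [NormedSpace ℝ E]

lemma exists_norm_iteratedFDeriv_mul_le {F : ι → E → ℝ} {G : κ → E → ℝ}
    (hF : ∀ i, ContDiff ℝ ((⊤ : ℕ∞) : WithTop ℕ∞) (F i))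
    (hG : ∀ j, ContDiff ℝ ((⊤ : ℕ∞) : WithTop ℕ∞) (G j))
    {V : ℕ → ι → ℝ} {W : ℕ → κ → ℝ} (hV0 : ∀ k i, 0 ≤ V k i)
    (hV : ∀ i, Monotone fun k => V k i) (hW : ∀ j, Monotone fun k => W k j)
    (hFV : ∀ k, ∃ C : ℝ, 0 ≤ C ∧ ∀ i x, ‖iteratedFDeriv ℝ k (F i) x‖ ≤ C * V k i)
    (hGW : ∀ k, ∃ C : ℝ, 0 ≤ C ∧ ∀ j x, ‖iteratedFDeriv ℝ k (G j) x‖ ≤ C * W k j) (k : ℕ) :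
    ∃ C : ℝ, 0 ≤ C ∧ ∀ (p : ι × κ) x,
      ‖iteratedFDeriv ℝ k (fun x => F p.1 x * G p.2 x) x‖ ≤ C * (V k p.1 * W k p.2) := by
  choose A hA0 hA using hFV
  choose B hB0 hB using hGW
  refine ⟨∑ i ∈ Finset.range (k + 1), (k.choose i : ℝ) * A i * B (k - i),
    Finset.sum_nonneg fun i _ => by have := hA0 i; have := hB0 (k - i); positivity,
    fun p x => ?_⟩
  refine (norm_iteratedFDeriv_mul_le (hF p.1) (hG p.2) x (n := k)
    (by exact_mod_cast le_top)).trans ?_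
  rw [Finset.sum_mul]
  refine Finset.sum_le_sum fun i hi => ?_
  have hik : i ≤ k := Nat.lt_succ_iff.1 (Finset.mem_range.1 hi)
  have h1 : ‖iteratedFDeriv ℝ i (F p.1) x‖ ≤ A i * V k p.1 :=
    (hA i _ x).trans (mul_le_mul_of_nonneg_left (hV _ hik) (hA0 i))
  have h2 : ‖iteratedFDeriv ℝ (k - i) (G p.2) x‖ ≤ B (k - i) * W k p.2 :=
    (hB _ _ x).trans (mul_le_mul_of_nonneg_left (hW _ (k.sub_le i)) (hB0 _))
  have := mul_nonneg (hA0 i) (hV0 k p.1)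
  calc _ ≤ (k.choose i : ℝ) * (A i * V k p.1) * (B (k - i) * W k p.2) := by gcongr
    _ = _ := by ring

lemma exists_norm_iteratedFDeriv_comp_le {f : ι → ℝ → ℝ}
    (hf : ∀ i, ContDiff ℝ ((⊤ : ℕ∞) : WithTop ℕ∞) (f i)) {V : ℕ → ι → ℝ}
    (hfV : ∀ k, ∃ C : ℝ, 0 ≤ C ∧ ∀ i x, ‖iteratedFDeriv ℝ k (f i) x‖ ≤ C * V k i)
    (g : E →L[ℝ] ℝ) (k : ℕ) :
    ∃ C : ℝ, 0 ≤ C ∧ ∀ i x, ‖iteratedFDeriv ℝ k (fun x => f i (g x)) x‖ ≤ C * V k i := by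
  obtain ⟨C, hC, hb⟩ := hfV k
  refine ⟨C * ‖g‖ ^ k, by positivity, fun i x => ?_⟩
  have := g.iteratedFDeriv_comp_right (hf i) x (i := k) (by exact_mod_cast le_top)
  rw [Function.comp_def] at this
  rw [this]
  refine (ContinuousMultilinearMap.norm_compContinuousLinearMap_le _ _).trans ?_
  rw [Finset.prod_const, Finset.card_univ, Fintype.card_fin]
  calc _ ≤ C * V k i * ‖g‖ ^ k := by gcongr; exact hb _ _
    _ = _ := by ring

end Smooth

/-- The scaled eigenfunction damped by `exp (-t ^ 2 / 2)`. It is a dilated Hermite function, and its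
derivative of order `k` is bounded on the whole line by a multiple of `geomWeight k n`. -/
noncomputable def dampedPhi (n : ℕ) (t : ℝ) : ℝ := scaledPhi n t * Real.exp (-t ^ 2 / 2)

lemma contDiff_dampedPhi (n : ℕ) : ContDiff ℝ ((⊤ : ℕ∞) : WithTop ℕ∞) (dampedPhi n) := by
  have h1 := contDiff_hermiteFun (N := ((⊤ : ℕ∞) : WithTop ℕ∞)) n
  have h2 : dampedPhi n = fun t => Real.sqrt (lam n) * b * hermiteFun n (h * t) :=
    funext fun t => sqrt_lam_mul_phi_mul_exp n t
  rw [h2]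
  fun_prop

lemma contDiff_dampedPhi_comp (n : ℕ) (i : Fin 3) :
    ContDiff ℝ ((⊤ : ℕ∞) : WithTop ℕ∞) fun x : E3 => dampedPhi n (x i) :=
  (contDiff_dampedPhi n).comp (EuclideanSpace.proj (𝕜 := ℝ) i).contDiff

lemma exists_norm_iteratedFDeriv_dampedPhi_prod_le (k : ℕ) :
    ∃ C : ℝ, 0 ≤ C ∧ ∀ (q : ℕ × ℕ × ℕ) (x : E3), ‖iteratedFDeriv ℝ k
      (fun x : E3 => dampedPhi q.1 (x 0) * (dampedPhi q.2.1 (x 1) * dampedPhi q.2.2 (x 2))) x‖ ≤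
      C * weight k q := by
  have h1 (i : Fin 3) (k : ℕ) : ∃ C : ℝ, 0 ≤ C ∧ ∀ (n : ℕ) (x : E3),
      ‖iteratedFDeriv ℝ k (fun x : E3 => dampedPhi n (x i)) x‖ ≤ C * geomWeight k n :=
    exists_norm_iteratedFDeriv_comp_le contDiff_dampedPhi exists_norm_iteratedFDeriv_le
      (EuclideanSpace.proj (𝕜 := ℝ) i) k
  refine exists_norm_iteratedFDeriv_mul_le (fun n => contDiff_dampedPhi_comp n 0)
    (fun p : ℕ × ℕ => (contDiff_dampedPhi_comp p.1 1).mul (contDiff_dampedPhi_comp p.2 2))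
    geomWeight_nonneg (W := fun k p => geomWeight k p.1 * geomWeight k p.2)
    geomWeight_mono (fun p i j hij => ?_) (h1 0) ?_ k
  · exact mul_le_mul (geomWeight_mono _ hij) (geomWeight_mono _ hij) (geomWeight_nonneg _ _)
      (geomWeight_nonneg _ _)
  · exact exists_norm_iteratedFDeriv_mul_le (fun n => contDiff_dampedPhi_comp n 1)
      (fun n => contDiff_dampedPhi_comp n 2) geomWeight_nonneg geomWeight_mono
      geomWeight_mono (h1 1) (h1 2)

/-! ### Convergence of the series for a summable sequence of coefficients -/

section Deterministic

variable {z : ℕ × ℕ × ℕ → ℝ}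

lemma abs_term_le (q : ℕ × ℕ × ℕ) (x : E3) :
    |z q * Real.sqrt (tau q) * psi q x| ≤
      |z q| * weight 0 q * (64 * Real.exp (a / 3 * ‖x‖ ^ 2)) := by
  rw [mul_assoc, abs_mul]
  calc _ ≤ |z q| * (64 * weight 0 q * Real.exp (a / 3 * ‖x‖ ^ 2)) := by
        gcongr; exact abs_sqrt_tau_mul_psi_le q x
    _ = _ := by ring

lemma summable_term (hz : Summable fun q => |z q| * weight 0 q) (x : E3) :
    Summable fun q => z q * Real.sqrt (tau q) * psi q x :=
  (hz.mul_right _).of_norm_bounded fun q => abs_term_le q x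

/-- The tail of the series is dominated, uniformly in `x`, by a tail of `∑ |z q| w q` times a fixed
function of `x`. -/
lemma abs_sum_sub_tsum_le (hz : Summable fun q => |z q| * weight 0 q)
    (s : Finset (ℕ × ℕ × ℕ)) (x : E3) :
    |(∑ q ∈ s, z q * Real.sqrt (tau q) * psi q x) - ∑' q, z q * Real.sqrt (tau q) * psi q x| ≤
      (∑' q : {q // q ∉ s}, |z q| * weight 0 q) * 64 * Real.exp (a / 3 * ‖x‖ ^ 2) := by
  rw [← (summable_term hz x).sum_add_tsum_subtype_compl s, sub_add_cancel_left, abs_neg, mul_assoc,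
    ← tsum_mul_right]
  exact tsum_of_norm_bounded (f := fun q : {q // q ∉ s} => z q * Real.sqrt (tau q) * psi q x)
    ((hz.mul_right (64 * Real.exp (a / 3 * ‖x‖ ^ 2))).comp_injective
      Subtype.val_injective).hasSum fun q => abs_term_le (z := z) q.1 x

theorem contDiff_tsum_term (hz : ∀ k, Summable fun q => |z q| * weight k q) :
    ContDiff ℝ ((⊤ : ℕ∞) : WithTop ℕ∞)
      fun x : E3 => ∑' q, z q * Real.sqrt (tau q) * psi q x := by
  choose C hC0 hC using exists_norm_iteratedFDeriv_dampedPhi_prod_le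
  let T : ℕ × ℕ × ℕ → E3 → ℝ := fun q x =>
    dampedPhi q.1 (x 0) * (dampedPhi q.2.1 (x 1) * dampedPhi q.2.2 (x 2))
  have hT (q) : ContDiff ℝ ((⊤ : ℕ∞) : WithTop ℕ∞) (T q) :=
    (contDiff_dampedPhi_comp q.1 0).mul
      ((contDiff_dampedPhi_comp q.2.1 1).mul (contDiff_dampedPhi_comp q.2.2 2))
  have h1 : ContDiff ℝ ((⊤ : ℕ∞) : WithTop ℕ∞) fun x : E3 => ∑' q, z q * T q x := by
    refine contDiff_tsum (v := fun k q => |z q| * weight k q * C k)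
      (fun q => contDiff_const.mul (hT q)) (fun k _ => (hz k).mul_right _) fun k q x _ => ?_
    have := iteratedFDeriv_const_smul_apply (a := z q) (i := k) (x := x)
      ((hT q).of_le (by exact_mod_cast le_top)).contDiffAt
    change ‖iteratedFDeriv ℝ k (z q • T q) x‖ ≤ _
    rw [this, norm_smul, Real.norm_eq_abs, mul_assoc, mul_comm (weight k q)]
    gcongr
    exact hC k q x
  have h2 : (fun x : E3 => ∑' q, z q * Real.sqrt (tau q) * psi q x) =
      fun x : E3 => Real.exp (‖x‖ ^ 2 / 2) * ∑' q, z q * T q x := by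
    ext x
    rw [← tsum_mul_left]
    refine tsum_congr fun q => ?_
    have he : Real.exp (‖x‖ ^ 2 / 2) *
        (Real.exp (-x 0 ^ 2 / 2) * (Real.exp (-x 1 ^ 2 / 2) * Real.exp (-x 2 ^ 2 / 2))) = 1 := by
      rw [← Real.exp_add, ← Real.exp_add, ← Real.exp_add, norm_sq_E3, ← Real.exp_zero]
      ring_nf
    rw [mul_assoc, sqrt_tau_mul_psi]
    simp only [T, dampedPhi]
    linear_combination (-(z q * (scaledPhi q.1 (x 0) * (scaledPhi q.2.1 (x 1) *
      scaledPhi q.2.2 (x 2))))) * he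
  rw [h2]
  exact ((contDiff_norm_sq ℝ).div_const 2).exp.mul h1

lemma contDiff_term (q : ℕ × ℕ × ℕ) {N : WithTop ℕ∞} :
    ContDiff ℝ N fun x : E3 => z q * Real.sqrt (tau q) * psi q x := by
  have hphi (n : ℕ) (i : Fin 3) : ContDiff ℝ N fun x : E3 => phi n (x i) := by
    have := contDiff_hermiteH (N := N) n
    unfold phi
    fun_prop
  exact contDiff_const.mul (((hphi _ _).mul (hphi _ _)).mul (hphi _ _))

lemma memLp_exp_theta : MemLp (fun x : E3 => Real.exp (a / 3 * ‖x‖ ^ 2)) 2 theta :=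
  memLp_exp_mul_norm_sq_theta (by linarith [a_lt_half, a_pos])

lemma memLp_term (q : ℕ × ℕ × ℕ) :
    MemLp (fun x : E3 => z q * Real.sqrt (tau q) * psi q x) 2 theta :=
  memLp_exp_theta.of_le_mul (c := |z q| * weight 0 q * 64)
    (contDiff_term q (N := 0)).continuous.aestronglyMeasurable
    (Eventually.of_forall fun x => by
      rw [Real.norm_of_nonneg (Real.exp_nonneg _)]
      exact (abs_term_le q x).trans_eq (by ring))

lemma memLp_tsum_term (hz : ∀ k, Summable fun q => |z q| * weight k q) :
    MemLp (fun x : E3 => ∑' q, z q * Real.sqrt (tau q) * psi q x) 2 theta :=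
  memLp_exp_theta.of_le_mul (c := (∑' q, |z q| * weight 0 q) * 64)
    (contDiff_tsum_term hz).continuous.aestronglyMeasurable
    (Eventually.of_forall fun x => by
      rw [Real.norm_of_nonneg (Real.exp_nonneg _), mul_assoc]
      exact tsum_of_norm_bounded ((hz 0).hasSum.mul_right _) fun q => abs_term_le q x)

theorem tendsto_eLpNorm_sum_sub_tsum (hz : Summable fun q => |z q| * weight 0 q) :
    Tendsto (fun s : Finset (ℕ × ℕ × ℕ) => eLpNorm (fun x : E3 =>
      (∑ q ∈ s, z q * Real.sqrt (tau q) * psi q x) -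
        ∑' q, z q * Real.sqrt (tau q) * psi q x) 2 theta) atTop (𝓝 0) := by
  have h1 : Tendsto (fun s : Finset (ℕ × ℕ × ℕ) =>
      ENNReal.ofReal ((∑' q : {q // q ∉ s}, |z q| * weight 0 q) * 64) *
        eLpNorm (fun x : E3 => Real.exp (a / 3 * ‖x‖ ^ 2)) 2 theta) atTop (𝓝 0) := by
    have h2 := ENNReal.tendsto_ofReal
      ((tendsto_tsum_compl_atTop_zero fun q => |z q| * weight 0 q).mul_const 64)
    simpa using ENNReal.Tendsto.mul_const h2 (Or.inr memLp_exp_theta.2.ne)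
  refine tendsto_of_tendsto_of_tendsto_of_le_of_le tendsto_const_nhds h1 (fun _ => zero_le)
    fun s => ?_
  refine eLpNorm_le_mul_eLpNorm_of_ae_le_mul (Eventually.of_forall fun x => ?_) 2
  rw [Real.norm_of_nonneg (Real.exp_nonneg _)]
  exact abs_sum_sub_tsum_le hz s x

end Deterministic

/-! ### The random field -/

section Field

variable {Ω : Type*} [MeasurableSpace Ω] {P : Measure Ω} {Z : ℕ × ℕ × ℕ → Ω → ℝ}

/-- Almost surely, the variables `Z q` grow slowly enough for all the deterministic convergence
results to apply at once. -/
lemma ae_forall_summable_weight (hlaw : ∀ q, HasLaw (Z q) (gaussianReal 0 1) P) :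
    ∀ᵐ ω ∂P, ∀ k, Summable fun q => |Z q ω| * weight k q :=
  ae_all_iff.2 fun k => ae_summable_abs_mul hlaw (weight_nonneg k) (summable_weight k)

lemma ae_hasSum_U (hlaw : ∀ q, HasLaw (Z q) (gaussianReal 0 1) P) :
    ∀ᵐ ω ∂P, ∀ x, HasSum (fun q => seriesTerm Z q x ω) (U Z x ω) := by
  filter_upwards [ae_forall_summable_weight hlaw] with ω hω x
  exact (summable_term (z := fun q => Z q ω) (hω 0) x).hasSum

variable [IsProbabilityMeasure P]

/-- Finite linear combinations of values of the field are centred Gaussian variables, whose variance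
is the quadratic form of the kernel. -/
theorem hasLaw_sum_mul_U (hlaw : ∀ q, HasLaw (Z q) (gaussianReal 0 1) P) (hindep : iIndepFun Z P)
    {J : Type*} [Fintype J] (l : J → ℝ) (x : J → E3) :
    ∃ v : NNReal, (v : ℝ) = ∑ i, ∑ j, l i * l j * kernel (x i) (x j) ∧
      HasLaw (fun ω => ∑ j, l j * U Z (x j) ω) (gaussianReal 0 v) P := by
  have hv : HasSum (fun q => (∑ j, l j * (Real.sqrt (tau q) * psi q (x j))) ^ 2)
      (∑ i, ∑ j, l i * l j * kernel (x i) (x j)) := by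
    refine (hasSum_sum fun i _ => hasSum_sum fun j _ =>
      (hasSum_kernel (x i) (x j)).mul_left (l i * l j)).congr_fun fun q => ?_
    rw [sq, Finset.sum_mul_sum]
    exact Finset.sum_congr rfl fun i _ => Finset.sum_congr rfl fun j _ => by ring
  refine ⟨⟨_, hv.nonneg fun q => sq_nonneg _⟩, rfl,
    hasLaw_gaussianReal_of_hasSum hlaw hindep hv ?_⟩
  filter_upwards [ae_hasSum_U hlaw] with ω hω
  refine (hasSum_sum fun j _ => (hω (x j)).mul_left (l j)).congr_fun fun q => ?_
  rw [Finset.mul_sum]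
  exact Finset.sum_congr rfl fun j _ => by rw [seriesTerm]; ring

lemma hasLaw_U (hlaw : ∀ q, HasLaw (Z q) (gaussianReal 0 1) P) (hindep : iIndepFun Z P) (x : E3) :
    ∃ v : NNReal, HasLaw (U Z x) (gaussianReal 0 v) P := by
  obtain ⟨v, -, hv⟩ := hasLaw_sum_mul_U hlaw hindep (fun _ : Unit => (1 : ℝ)) fun _ => x
  exact ⟨v, by simpa using hv⟩

theorem isGaussianProcess_U (hlaw : ∀ q, HasLaw (Z q) (gaussianReal 0 1) P)
    (hindep : iIndepFun Z P) : IsGaussianProcess (U Z) P := by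
  refine ⟨fun I => ⟨isGaussian_of_map_eq_gaussianReal fun L => ?_⟩⟩
  obtain ⟨v, -, hv⟩ := hasLaw_sum_mul_U hlaw hindep (fun i : I => L (Pi.single i 1)) fun i => i.1
  have hm : AEMeasurable (fun ω => I.restrict fun x => U Z x ω) P :=
    aemeasurable_pi_lambda _ fun i => (hasLaw_U hlaw hindep i.1).choose_spec.aemeasurable
  refine ⟨0, v, ?_⟩
  rw [AEMeasurable.map_map_of_aemeasurable L.continuous.measurable.aemeasurable hm, ← hv.map_eq]
  congr 1
  ext ω
  have := LinearMap.pi_apply_eq_sum_univ L.toLinearMap (I.restrict fun x => U Z x ω)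
  simp only [ContinuousLinearMap.coe_coe, smul_eq_mul] at this
  rw [Function.comp_apply, this]
  refine Finset.sum_congr rfl fun i _ => ?_
  rw [mul_comm]
  congr 2
  ext j
  simp [Pi.single_apply, eq_comm]

/-- The covariance is obtained from the variances of `U x + U y` and `U x - U y`. -/
theorem integral_U_mul_U (hlaw : ∀ q, HasLaw (Z q) (gaussianReal 0 1) P) (hindep : iIndepFun Z P)
    (x y : E3) : ∫ ω, U Z x ω * U Z y ω ∂P = kernel x y := by
  obtain ⟨v, hv, hX⟩ := hasLaw_sum_mul_U hlaw hindep ![1, 1] ![x, y]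
  obtain ⟨w, hw, hY⟩ := hasLaw_sum_mul_U hlaw hindep ![1, -1] ![x, y]
  obtain ⟨i1, e1⟩ := integral_sq_of_hasLaw_gaussianReal hX
  obtain ⟨i2, e2⟩ := integral_sq_of_hasLaw_gaussianReal hY
  have hsymm : kernel y x = kernel x y := by rw [kernel, kernel, norm_sub_rev]
  have hpol : (fun ω => U Z x ω * U Z y ω) = fun ω => 4⁻¹ *
      ((∑ j, (![1, 1] : Fin 2 → ℝ) j * U Z ((![x, y] : Fin 2 → E3) j) ω) ^ 2 -
        (∑ j, (![1, -1] : Fin 2 → ℝ) j * U Z ((![x, y] : Fin 2 → E3) j) ω) ^ 2) := by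
    ext ω
    simp [Fin.sum_univ_two]
    ring
  rw [hpol, integral_const_mul, integral_sub i1 i2, e1, e2, hv, hw]
  simp [Fin.sum_univ_two, hsymm]
  ring

end Field

end GaussField

theorem mainTheorem1 {Ω : Type*} [MeasurableSpace Ω] (P : Measure Ω) [IsProbabilityMeasure P]
    (Z : ℕ × ℕ × ℕ → Ω → ℝ)
    (hZ_law : ∀ q, HasLaw (Z q) (gaussianReal 0 1) P)
    (hZ_indep : iIndepFun Z P) :
    -- almost surely, pointwise convergence at every point
    (∀ᵐ ω ∂P, ∀ x : GaussField.E3,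
      HasSum (fun q => GaussField.seriesTerm Z q x ω) (GaussField.U Z x ω)) ∧
    -- the sum is a Gaussian field, centred, with covariance kernel `k`
    IsGaussianProcess (GaussField.U Z) P ∧
    (∀ x : GaussField.E3, ∫ ω, GaussField.U Z x ω ∂P = 0) ∧
    (∀ x y : GaussField.E3,
      ∫ ω, GaussField.U Z x ω * GaussField.U Z y ω ∂P = GaussField.kernel x y) ∧
    -- almost surely, the sum is square integrable with respect to `θ`
    (∀ᵐ ω ∂P, MemLp (fun x => GaussField.U Z x ω) 2 GaussField.theta) ∧
    -- almost surely, the sum is infinitely differentiable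
    (∀ᵐ ω ∂P, ContDiff ℝ ((⊤ : ℕ∞) : WithTop ℕ∞) (fun x => GaussField.U Z x ω)) ∧
    -- almost surely, the terms lie in `L²(θ)` and the series converges to `U` in `L²(θ)`
    (∀ᵐ ω ∂P,
      (∀ q, MemLp (fun x => GaussField.seriesTerm Z q x ω) 2 GaussField.theta) ∧
      Tendsto
        (fun s : Finset (ℕ × ℕ × ℕ) =>
          eLpNorm (fun x => (∑ q ∈ s, GaussField.seriesTerm Z q x ω) - GaussField.U Z x ω) 2
            GaussField.theta)
        atTop (𝓝 0)) := by
  have hw := GaussField.ae_forall_summable_weight hZ_law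
  refine ⟨GaussField.ae_hasSum_U hZ_law, GaussField.isGaussianProcess_U hZ_law hZ_indep,
    fun x => ?_, GaussField.integral_U_mul_U hZ_law hZ_indep, ?_, ?_, ?_⟩
  · obtain ⟨v, hv⟩ := GaussField.hasLaw_U hZ_law hZ_indep x
    exact hv.integral_eq.trans integral_id_gaussianReal
  · filter_upwards [hw] with ω hω
    exact GaussField.memLp_tsum_term (z := fun q => Z q ω) hω
  · filter_upwards [hw] with ω hω
    exact GaussField.contDiff_tsum_term (z := fun q => Z q ω) hω
  · filter_upwards [hw] with ω hω
    exact ⟨fun q => GaussField.memLp_term (z := fun q => Z q ω) q,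
      GaussField.tendsto_eLpNorm_sum_sub_tsum (z := fun q => Z q ω) (hω 0)⟩
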